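/- Let $R$ be a noetherian commutative ring, let $S=\operatorname{Spec} R$, let $N\ge 0$ be an integer, and let $\pi:\mathbb A^N_S\to S$ be affine $N$-space over $S$. For a subset $T\subseteq \mathbb A^N_S$ and $s\in S$, write $T_s=T\cap\pi^{-1}(s)$, viewed as a subset of $\mathbb A^N_{k(s)}$, where $k(s)$ is the residue field of $s$; for an open subset $V\subseteq S$, write $\mathbb A^N_V=\pi^{-1}(V)$. A subset of $\mathbb A^N_S$ is called pro-constructible if it is a (possibly infinite) intersection of constructible subsets. The dimension of a subset is the Krull dimension of the subset with the induced topology; the empty set has negative dimension. Let $T=T_1\cup\dots\cup T_m$ be a finite union of pro-constructible subsets of $\mathbb A^N_S$. Suppose that: (1) There exists an open subset $V\subseteq S$ whose complement has dimension at most $0$ (the complement may be empty) such that for all $i\le m$ we have $\dim(T_i\cap\mathbb A^N_V)<N$, and $(T_i)_s$ is constructible in $\mathbb A^N_{k(s)}$ for all $s\in V$. (2) For every $s\in S$ there exists a $k(s)$-rational point of $\mathbb A^N_{k(s)}$ which does not belong to $T_s$. Then there exists a section $\sigma:S\to\mathbb A^N_S$ of $\pi$ such that $\sigma(S)\cap T=\emptyset$.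 -/

import Mathlib

open CategoryTheory AlgebraicGeometry

universe u

/-- A subset of a topological space (below: of a noetherian scheme) is pro-constructible if it is a
(possibly infinite) intersection of constructible subsets. -/
def IsProConstructible {X : Type u} [TopologicalSpace X] (T : Set X) : Prop :=
  ∃ 𝒞 : Set (Set X), (∀ C ∈ 𝒞, Topology.IsConstructible C) ∧ T = ⋂₀ 𝒞

/-- Affine `N`-space `𝔸^N_S` over a scheme `S`. -/
noncomputable abbrev affineNSpace (N : ℕ) (S : Scheme.{u}) : Scheme.{u} :=
  𝔸(ULift.{u} (Fin N); S)

/-- The structure morphism `π : 𝔸^N_S ⟶ S`. -/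
noncomputable abbrev affineNSpaceProj (N : ℕ) (S : Scheme.{u}) : affineNSpace N S ⟶ S :=
  𝔸(ULift.{u} (Fin N); S) ↘ S

/-- The canonical morphism `𝔸^N_{k(s)} ⟶ 𝔸^N_S`, which identifies `𝔸^N_{k(s)}` with the
fiber of `π` at `s`. -/
noncomputable abbrev affineNSpaceFiberMap (N : ℕ) (S : Scheme.{u}) (s : S) :
    affineNSpace N (Spec (S.residueField s)) ⟶ affineNSpace N S :=
  AffineSpace.map (ULift.{u} (Fin N)) (S.fromSpecResidueField s)

/-- The fiber `T_s` of a subset `T` of `𝔸^N_S`, as a subset of `𝔸^N_{k(s)}`. -/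
def fiberSet {N : ℕ} {S : Scheme.{u}} (T : Set (affineNSpace N S)) (s : S) :
    Set (affineNSpace N (Spec (S.residueField s))) :=
  affineNSpaceFiberMap N S s ⁻¹' T

/-!
Over `S = Spec R`, a section of affine space is an `N`-tuple `a` of elements of `R`, and the sets
`T i` become pro-constructible sets of primes of `R[x₁, …, x_N]`.

Pro-constructible sets of primes of a noetherian ring have finitely many minimal elements
(`IsProConstructible.exists_finite_forall_exists_le`). Therefore an equation `y = b` with `b ∈ R`
can be imposed so that the hypersurface avoids the minimal points of all `T i` that lie over primes
with infinite residue field: each of them excludes at most one residue class of `b`, and the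
conditions at the finitely many primes concerned can be satisfied simultaneously
(`PrimeSpectrum.exists_forall_of_forall_exists_add_mul`). A point that remains on the hypersurface
has then height at least one more. After `N` choices, a point of `T i` on the section would have
height at least `N` in `T i`, against the dimension hypothesis, unless it lies above a point of
`T i` over a prime with finite residue field (`exists_forall_le_height_or_finite`).

Such a prime is a closed point of `S`, and is dealt with by the last choice. The fibers of the
`T i` over the open set `V` are constructible of dimension less than `N`, hence contained in
hypersurfaces (`exists_map_ne_zero_forall_mem`), and by noetherian induction equations of these can
be chosen with all exponents less than some `M` independent of the fiber
(`exists_forall_exists_degreeOf_lt`). The first `N - 1` choices are made for the functions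
`y_l = x_l - x_0 ^ (M ^ l)` with `0 < l < N`, so that the last one, that of `x_0`, leaves a
polynomial in one variable, nonzero over each residue field and of degree less than `M ^ N`
(`MvPolynomial.aeval_monic_ne_zero_and_natDegree_lt`). It has a nonroot in every field with more
than `M ^ N` elements. Only finitely many primes have a residue field with at most `M ^ N` elements
(`PrimeSpectrum.finite_setOf_card_quotient_le`). At these, and at the finitely many closed points
outside `V`, all coordinates are prescribed by the given rational points. The two parts are put
together in `exists_forall_sectionPoint_notMem`.
-/

/-! ### Pro-constructible sets and noetherian induction in prime spectra -/

/-- Membership in a constructible set is constant on a dense open part of each irreducible closed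
subset of a prime spectrum. -/
lemma Topology.IsConstructible.exists_basicOpen_mem_iff {A : Type*} [CommRing A]
    {C : Set (PrimeSpectrum A)} (hC : Topology.IsConstructible C) (p : PrimeSpectrum A) :
    ∃ g ∉ p.asIdeal, ∀ q : PrimeSpectrum A, p ≤ q → g ∉ q.asIdeal → (q ∈ C ↔ p ∈ C) := by
  induction hC using Topology.IsConstructible.empty_union_induction with
  | open_retrocompact U hU _ =>
    by_cases hp : p ∈ U
    · obtain ⟨_, ⟨g, rfl⟩, hg, hgU⟩ :=
        PrimeSpectrum.isTopologicalBasis_basic_opens.exists_subset_of_mem_open hp hU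
      exact ⟨g, hg, fun q _ hq => iff_of_true (hgU hq) hp⟩
    · refine ⟨1, p.asIdeal.one_notMem, fun q hpq _ => iff_of_false (fun hq => hp ?_) hp⟩
      exact ((PrimeSpectrum.le_iff_specializes p q).mp hpq).mem_open hU hq
  | union s _ t _ hs ht =>
    obtain ⟨g, hg, hgs⟩ := hs
    obtain ⟨h, hh, hht⟩ := ht
    refine ⟨g * h, fun hmem => (p.isPrime.mem_or_mem hmem).elim hg hh, fun q hpq hq => ?_⟩
    exact or_congr (hgs q hpq fun h' => hq (Ideal.mul_mem_right _ _ h'))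
      (hht q hpq fun h' => hq (Ideal.mul_mem_left _ _ h'))
  | compl s _ hs =>
    obtain ⟨g, hg, hgs⟩ := hs
    exact ⟨g, hg, fun q hpq hq => not_congr (hgs q hpq hq)⟩

lemma IsProConstructible.inter {X : Type u} [TopologicalSpace X] {S T : Set X}
    (hS : IsProConstructible S) (hT : IsProConstructible T) : IsProConstructible (S ∩ T) := by
  obtain ⟨C, hC, rfl⟩ := hS
  obtain ⟨D, hD, rfl⟩ := hT
  exact ⟨C ∪ D, fun E hE => hE.elim (hC E) (hD E), (Set.sInter_union C D).symm⟩

lemma IsProConstructible.of_isConstructible {X : Type u} [TopologicalSpace X] {S : Set X}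
    (hS : Topology.IsConstructible S) : IsProConstructible S :=
  ⟨{S}, by simpa using hS, by simp⟩

lemma IsProConstructible.of_isOpen {X : Type u} [TopologicalSpace X]
    [TopologicalSpace.NoetherianSpace X] {S : Set X} (hS : IsOpen S) : IsProConstructible S :=
  .of_isConstructible <| IsRetrocompact.isConstructible hS
    fun _ _ _ => TopologicalSpace.NoetherianSpace.isCompact _

lemma IsProConstructible.of_isClosed {X : Type u} [TopologicalSpace X]
    [TopologicalSpace.NoetherianSpace X] {S : Set X} (hS : IsClosed S) : IsProConstructible S := by
  refine .of_isConstructible (Topology.isConstructible_compl.mp ?_)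
  exact IsRetrocompact.isConstructible hS.isOpen_compl
    fun _ _ _ => TopologicalSpace.NoetherianSpace.isCompact _

/-- The minimal elements of a pro-constructible set of primes of a noetherian ring are finite in
number, and every element of the set lies above one of them: they are the minimal primes over the
intersection of the set. -/
lemma IsProConstructible.exists_finite_forall_exists_le {A : Type u} [CommRing A]
    [IsNoetherianRing A] {Q : Set (PrimeSpectrum A)} (hQ : IsProConstructible Q) :
    ∃ F ⊆ Q, F.Finite ∧ ∀ q ∈ Q, ∃ p ∈ F, p ≤ q := by
  obtain ⟨𝒞, h𝒞, rfl⟩ := hQ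
  set Q := ⋂₀ 𝒞 with hQdef
  let I := PrimeSpectrum.vanishingIdeal Q
  have hfin : I.minimalPrimes.Finite := I.finite_minimalPrimes_of_isNoetherianRing A
  have hIle : ∀ q ∈ Q, I ≤ q.asIdeal := fun q hq f hf =>
    (PrimeSpectrum.mem_vanishingIdeal _ _).mp hf q hq
  refine ⟨{p | p.asIdeal ∈ I.minimalPrimes}, ?_, ?_, ?_⟩
  · intro p hp C hC
    by_contra hpC
    obtain ⟨g, hg, hgC⟩ := (h𝒞 C hC).exists_basicOpen_mem_iff p
    -- `h` lies in all minimal primes over `I` except `p`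
    obtain ⟨h, hh, hhp⟩ : ∃ h ∈ ⨅ J ∈ hfin.toFinset.erase p.asIdeal, J, h ∉ p.asIdeal := by
      refine SetLike.not_le_iff_exists.mp fun hle => ?_
      obtain ⟨J, hJ, hJp⟩ := (Ideal.IsPrime.inf_le' p.isPrime).mp
        ((Finset.inf_eq_iInf _ _).trans_le hle)
      simp only [Finset.mem_erase, Set.Finite.mem_toFinset] at hJ
      exact hJ.1 (le_antisymm hJp (hp.2 hJ.2.1 hJp))
    have hghI : g * h ∈ I := by
      refine (PrimeSpectrum.mem_vanishingIdeal _ _).mpr fun q hq => ?_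
      obtain ⟨J, hJ, hJq⟩ := Ideal.exists_minimalPrimes_le (hIle q hq)
      by_cases hJp : J = p.asIdeal
      · refine Ideal.mul_mem_right _ _ ?_
        by_contra hgq
        exact hpC ((hgC q (hJp.symm.le.trans hJq) hgq).mp (hq C hC))
      · refine Ideal.mul_mem_left _ _ (hJq ?_)
        simp only [Ideal.mem_iInf] at hh
        exact hh J (by simp [hJp, hJ])
    exact (p.isPrime.mem_or_mem (hp.1.2 hghI)).elim hg hhp
  · exact hfin.preimage fun _ _ _ _ => PrimeSpectrum.ext
  · intro q hq
    obtain ⟨J, hJ, hJq⟩ := Ideal.exists_minimalPrimes_le (hIle q hq)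
    exact ⟨⟨J, hJ.1.1⟩, hJ, hJq⟩

/-- Noetherian induction on the prime spectrum: a property of sets of primes that passes to
subsets and finite unions, and that every irreducible closed subset has on a dense open part,
holds for every set. -/
lemma PrimeSpectrum.noetherian_induction_sets {R : Type*} [CommRing R] [IsNoetherianRing R]
    (Φ : Set (PrimeSpectrum R) → Prop) (hempty : Φ ∅)
    (hmono : ∀ {B C : Set (PrimeSpectrum R)}, B ⊆ C → Φ C → Φ B)
    (hunion : ∀ {B C : Set (PrimeSpectrum R)}, Φ B → Φ C → Φ (B ∪ C))
    (h : ∀ p : PrimeSpectrum R, ∃ g ∉ p.asIdeal, Φ {s | p ≤ s ∧ g ∉ s.asIdeal}) (B) : Φ B := by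
  suffices ∀ I : Ideal R, Φ {s | I ≤ s.asIdeal} from
    hmono (C := {s | ⊥ ≤ s.asIdeal}) (fun s _ => bot_le (a := s.asIdeal)) (this ⊥)
  intro I
  induction I using IsNoetherian.induction with
  | _ I ih =>
  have hbU : ∀ (F : Set (Ideal R)), F.Finite → (∀ J ∈ F, Φ {s | J ≤ s.asIdeal}) →
      Φ (⋃ J ∈ F, {s | J ≤ s.asIdeal}) := by
    intro F hF hΦ
    induction F, hF using Set.Finite.induction_on with
    | empty => simpa using hempty
    | insert _ _ ih' =>
      rw [Set.biUnion_insert]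
      exact hunion (hΦ _ (Set.mem_insert _ _)) (ih' fun J hJ => hΦ J (Set.mem_insert_of_mem _ hJ))
  refine hmono (C := ⋃ J ∈ Ideal.minimalPrimes I, {s | J ≤ s.asIdeal}) (fun s hs => ?_)
    (hbU _ (Ideal.finite_minimalPrimes_of_isNoetherianRing R I) fun J hJ => ?_)
  · obtain ⟨J, hJ, hJs⟩ := Ideal.exists_minimalPrimes_le hs
    exact Set.mem_biUnion hJ hJs
  · obtain ⟨g, hg, hΦ⟩ := h ⟨J, hJ.1.1⟩
    have hlt : I < J ⊔ Ideal.span {g} := lt_of_le_of_ne (hJ.1.2.trans le_sup_left) fun heq => by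
      refine hg (hJ.1.2 ?_)
      rw [heq]
      exact Ideal.mem_sup_right (Ideal.mem_span_singleton_self g)
    refine hmono (fun s hs => ?_) (hunion hΦ (ih _ hlt))
    by_cases hgs : g ∈ s.asIdeal
    · exact Or.inr (sup_le hs ((Ideal.span_singleton_le_iff_mem _).mpr hgs))
    · exact Or.inl ⟨hs, hgs⟩

/-- A noetherian ring has only finitely many primes whose residue field has at most `D`
elements. -/
lemma PrimeSpectrum.finite_setOf_card_quotient_le (R : Type*) [CommRing R] [IsNoetherianRing R]
    (D : ℕ) :
    {s : PrimeSpectrum R | Finite (R ⧸ s.asIdeal) ∧ Nat.card (R ⧸ s.asIdeal) ≤ D}.Finite := by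
  set B := {s : PrimeSpectrum R | Finite (R ⧸ s.asIdeal) ∧ Nat.card (R ⧸ s.asIdeal) ≤ D}
  suffices ∀ E, (B ∩ E).Finite by simpa using this Set.univ
  refine PrimeSpectrum.noetherian_induction_sets (fun E => (B ∩ E).Finite) (by simp)
    (fun h hC => hC.subset (Set.inter_subset_inter_right _ h))
    (fun h h' => by rw [Set.inter_union_distrib_left]; exact h.union h') fun p => ?_
  by_cases hp : Finite (R ⧸ p.asIdeal)
  · refine ⟨1, p.asIdeal.one_notMem, (Set.finite_singleton p).subset ?_⟩
    rintro s ⟨-, hps, -⟩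
    have : p.asIdeal.IsMaximal := Ideal.Quotient.maximal_of_isField _
      (Finite.isField_of_domain (R ⧸ p.asIdeal))
    exact PrimeSpectrum.ext (this.eq_of_le s.isPrime.ne_top hps).symm
  · -- some `a` is not a root modulo `p` of the polynomial `∏ (X ^ q - X)`, of which every
    -- element of a field with at most `D` elements is a root
    let h : Polynomial ℤ := ∏ q ∈ Finset.Icc 2 D, (Polynomial.X ^ q - Polynomial.X)
    have hmonic : h.Monic := Polynomial.monic_prod_of_monic _ _ fun q hq =>
      Polynomial.monic_X_pow_sub (by
        rw [Polynomial.degree_X]; exact_mod_cast (Finset.mem_Icc.mp hq).1)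
    have hne : h.map (Int.castRingHom (R ⧸ p.asIdeal)) ≠ 0 := (hmonic.map _).ne_zero
    have : Infinite (R ⧸ p.asIdeal) := not_finite_iff_infinite.mp hp
    obtain ⟨a, ha⟩ : ∃ a, (h.map (Int.castRingHom (R ⧸ p.asIdeal))).eval a ≠ 0 := by
      by_contra! hall
      exact hne (Polynomial.funext fun r => by simpa using hall r)
    obtain ⟨a, rfl⟩ := Ideal.Quotient.mk_surjective a
    have key : ∀ s : PrimeSpectrum R, (h.map (Int.castRingHom (R ⧸ s.asIdeal))).eval
        (Ideal.Quotient.mk s.asIdeal a) = Ideal.Quotient.mk s.asIdeal (h.aeval a) := fun s => by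
      rw [Polynomial.eval_map, Polynomial.aeval_def, Polynomial.hom_eval₂]
      congr 1
    refine ⟨h.aeval a, fun hmem => ha ?_, ?_⟩
    · rw [key, Ideal.Quotient.eq_zero_iff_mem.mpr hmem]
    · convert Set.finite_empty
      refine Set.eq_empty_iff_forall_notMem.mpr ?_
      rintro s ⟨⟨hfin, hcard⟩, -, hs⟩
      refine hs (Ideal.Quotient.eq_zero_iff_mem.mp ?_)
      have hmax : s.asIdeal.IsMaximal := Ideal.Quotient.maximal_of_isField _
        (Finite.isField_of_domain (R ⧸ s.asIdeal))
      let _ : Field (R ⧸ s.asIdeal) := Ideal.Quotient.field _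
      have := Fintype.ofFinite (R ⧸ s.asIdeal)
      rw [← key, Polynomial.map_prod, Polynomial.eval_prod]
      refine Finset.prod_eq_zero (i := Nat.card (R ⧸ s.asIdeal))
        (Finset.mem_Icc.mpr ⟨Finite.one_lt_card, hcard⟩) ?_
      rw [Nat.card_eq_fintype_card]
      simp [FiniteField.pow_card]

/-- Simultaneous choice modulo finitely many primes. A minimal one, `p`, is treated last: it
contains none of the others, so that the choice made for these can be corrected by a multiple of
an element that lies in all of them and not in `p`. -/
lemma PrimeSpectrum.exists_forall_of_forall_exists_add_mul {R : Type*} [CommRing R]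
    (P : Finset (PrimeSpectrum R)) (good : PrimeSpectrum R → R → Prop)
    (hcongr : ∀ p ∈ P, ∀ a b, a - b ∈ p.asIdeal → good p a → good p b)
    (h : ∀ p ∈ P, ∀ a b, b ∉ p.asIdeal → ∃ c, good p (a + b * c)) :
    ∃ a, ∀ p ∈ P, good p a := by
  classical
  induction P using Finset.strongInduction with
  | H P ih =>
  rcases P.eq_empty_or_nonempty with rfl | hne
  · exact ⟨0, by simp⟩
  obtain ⟨p, hp⟩ := P.exists_minimal hne
  obtain ⟨a, ha⟩ := ih (P.erase p) (Finset.erase_ssubset hp.1)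
    (fun q hq => hcongr q (Finset.mem_of_mem_erase hq))
    (fun q hq => h q (Finset.mem_of_mem_erase hq))
  obtain ⟨b, hb, hbp⟩ : ∃ b ∈ (P.erase p).inf PrimeSpectrum.asIdeal, b ∉ p.asIdeal := by
    refine SetLike.not_le_iff_exists.mp fun hle => ?_
    obtain ⟨q, hq, hqp⟩ := (Ideal.IsPrime.inf_le' p.isPrime).mp hle
    exact Finset.ne_of_mem_erase hq (le_antisymm hqp (hp.2 (Finset.mem_of_mem_erase hq) hqp))
  obtain ⟨c, hc⟩ := h p hp.1 a b hbp
  refine ⟨a + b * c, fun q hq => ?_⟩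
  rcases eq_or_ne q p with rfl | hqp
  · exact hc
  · have hqe := Finset.mem_erase.mpr ⟨hqp, hq⟩
    refine hcongr q hq a _ ?_ (ha q hqe)
    have : b ∈ q.asIdeal := Finset.inf_le (f := PrimeSpectrum.asIdeal) hqe hb
    simpa using Ideal.mul_mem_right c _ this

/-! ### Nagata's substitution and the choice of coordinates -/

/-- Nagata's substitution. If all exponents of a nonzero polynomial `f` are less than `M`, then
substituting monic polynomials of degrees `1, M, M², …` for the variables gives a nonzero
polynomial: distinct monomials of `f` become polynomials of distinct degrees. -/
lemma MvPolynomial.aeval_monic_ne_zero_and_natDegree_lt {K : Type*} [CommRing K] {n M : ℕ}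
    {f : MvPolynomial (Fin n) K} (hf : f ≠ 0) (hM : ∀ l, f.degreeOf l < M)
    (q : Fin n → Polynomial K) (hq : ∀ l, (q l).Monic) (hdeg : ∀ l, (q l).natDegree = M ^ (l : ℕ)) :
    MvPolynomial.aeval q f ≠ 0 ∧ (MvPolynomial.aeval q f).natDegree < M ^ n := by
  classical
  have : Nontrivial K := by
    by_contra h
    have := not_nontrivial_iff_subsingleton.mp h
    exact hf (Subsingleton.elim _ _)
  have hlt : ∀ α ∈ f.support, ∀ l, α l < M := fun α hα l =>
    (MvPolynomial.le_degreeOf_of_mem_support l hα).trans_lt (hM l)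
  let W : (Fin n →₀ ℕ) → ℕ := fun α => ∑ l, α l * M ^ (l : ℕ)
  have hW : ∀ α (hα : α ∈ f.support),
      W α = finFunctionFinEquiv (fun l => (⟨α l, hlt α hα l⟩ : Fin M)) := fun α hα => by
    rw [finFunctionFinEquiv_apply]
  have hWlt : ∀ α ∈ f.support, W α < M ^ n := fun α hα => by
    rw [hW α hα]; exact Fin.is_lt _
  have hWinj : ∀ α ∈ f.support, ∀ β ∈ f.support, W α = W β → α = β := fun α hα β hβ h => by
    rw [hW α hα, hW β hβ] at h
    have h' := finFunctionFinEquiv.injective (Fin.ext h)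
    ext l
    simpa using congrArg Fin.val (congrFun h' l)
  let τ : (Fin n →₀ ℕ) → Polynomial K := fun α =>
    Polynomial.C (f.coeff α) * ∏ l, q l ^ α l
  have hmonic : ∀ α : Fin n →₀ ℕ, (∏ l, q l ^ α l).Monic := fun α =>
    Polynomial.monic_prod_of_monic _ _ fun l _ => (hq l).pow _
  have hτ : ∀ α ∈ f.support, (τ α).degree = W α := fun α hα => by
    have hnd : (∏ l, q l ^ α l).natDegree = W α := by
      rw [Polynomial.natDegree_prod_of_monic _ _ fun l _ => (hq l).pow _]
      exact Finset.sum_congr rfl fun l _ => by rw [(hq l).natDegree_pow, hdeg]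
    rw [(hmonic α).degree_mul, Polynomial.degree_C (MvPolynomial.mem_support_iff.mp hα), zero_add,
      Polynomial.degree_eq_natDegree (hmonic α).ne_zero, hnd]
  have hsum : MvPolynomial.aeval q f = ∑ α ∈ f.support, τ α := by
    rw [MvPolynomial.aeval_def, MvPolynomial.eval₂_eq']
    rfl
  have hdegree : (MvPolynomial.aeval q f).degree = f.support.sup fun α => (τ α).degree := by
    rw [hsum]
    refine Polynomial.degree_sum_eq_of_disjoint _ _ fun α hα β hβ hne h => hne ?_
    rw [Function.comp, Function.comp, hτ α hα.1, hτ β hβ.1] at h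
    exact hWinj α hα.1 β hβ.1 (by exact_mod_cast h)
  obtain ⟨α, hα⟩ := MvPolynomial.support_nonempty.mpr hf
  have hne : MvPolynomial.aeval q f ≠ 0 := by
    rw [← Polynomial.degree_ne_bot, hdegree]
    refine ne_bot_of_le_ne_bot ?_ (Finset.le_sup (f := fun α => (τ α).degree) hα)
    rw [hτ α hα]
    exact WithBot.coe_ne_bot
  refine ⟨hne, ?_⟩
  rw [Polynomial.natDegree_lt_iff_degree_lt hne, hdegree,
    Finset.sup_lt_iff (WithBot.bot_lt_coe _)]
  intro β hβ
  rw [hτ β hβ]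
  exact_mod_cast hWlt β hβ

/-- Choice of one coordinate. The element `b` is chosen with prescribed residues at the finite set
`P` of maximal ideals, such that the hypersurface `y = b` contains no minimal element `t` of `Q i`
lying over a prime with infinite residue field, and such that `b` satisfies `G` at the images of
the minimal elements of `Q i` lying over primes with finite residue field. -/
lemma exists_forall_exists_le_of_sub_mem {R A : Type u} [CommRing R] [CommRing A]
    [IsNoetherianRing A] [Algebra R A] {ι : Type*} [Finite ι] {Q : ι → Set (PrimeSpectrum A)}
    (hQ : ∀ i, IsProConstructible (Q i)) {P : Set (PrimeSpectrum R)} (hPfin : P.Finite)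
    (hPmax : ∀ p ∈ P, p.asIdeal.IsMaximal)
    (hPQ : ∀ i, ∀ t ∈ Q i, t.comap (algebraMap R A) ∉ P) (v : PrimeSpectrum R → R) (y : A)
    (G : PrimeSpectrum R → R → Prop)
    (hGcongr : ∀ p a b, a - b ∈ p.asIdeal → G p a → G p b)
    (hG : ∀ i, ∀ t ∈ Q i, Finite (R ⧸ (t.comap (algebraMap R A)).asIdeal) →
      ∃ a, G (t.comap (algebraMap R A)) a) :
    ∃ b : R, (∀ p ∈ P, b - v p ∈ p.asIdeal) ∧
      ∀ i, ∀ t ∈ Q i, y - algebraMap R A b ∈ t.asIdeal → ∃ t' ∈ Q i, t' ≤ t ∧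
        (Finite (R ⧸ (t'.comap (algebraMap R A)).asIdeal) ∧ G (t'.comap (algebraMap R A)) b ∨
          Infinite (R ⧸ (t'.comap (algebraMap R A)).asIdeal) ∧ t' < t) := by
  classical
  choose F hFQ hFfin hF using fun i => (hQ i).exists_finite_forall_exists_le
  have hUfin : (⋃ i, F i).Finite := Set.finite_iUnion hFfin
  let π : PrimeSpectrum A → PrimeSpectrum R := PrimeSpectrum.comap (algebraMap R A)
  have hfin : (P ∪ π '' ⋃ i, F i).Finite := hPfin.union (hUfin.image π)
  let good : PrimeSpectrum R → R → Prop := fun p a =>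
    (p ∈ P → a - v p ∈ p.asIdeal) ∧ (p ∉ P → Finite (R ⧸ p.asIdeal) → G p a) ∧
      (Infinite (R ⧸ p.asIdeal) → ∀ t ∈ ⋃ i, F i, π t = p → y - algebraMap R A a ∉ t.asIdeal)
  have hmaxadd : ∀ p : PrimeSpectrum R, p.asIdeal.IsMaximal → ∀ a b d, b ∉ p.asIdeal →
      ∃ c, d - (a + b * c) ∈ p.asIdeal := by
    intro p hp a b d hb
    obtain ⟨z, i, hi, hz⟩ := hp.exists_inv hb
    refine ⟨z * (d - a), ?_⟩
    convert p.asIdeal.mul_mem_right (d - a) hi using 1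
    linear_combination (a - d) * hz
  obtain ⟨b, hb⟩ := PrimeSpectrum.exists_forall_of_forall_exists_add_mul hfin.toFinset good
    (fun p hp a b hab hga => by
      refine ⟨fun hpP => ?_, fun hpP hpf => hGcongr p a b hab (hga.2.1 hpP hpf),
        fun hpi t ht htp hmem => hga.2.2 hpi t ht htp ?_⟩
      · simpa using sub_mem (hga.1 hpP) hab
      · have : algebraMap R A (a - b) ∈ t.asIdeal := by subst htp; exact hab
        rw [map_sub] at this
        simpa using sub_mem hmem this)
    (fun p hp a b hbp => by
      rw [Set.Finite.mem_toFinset] at hp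
      by_cases hpP : p ∈ P
      · obtain ⟨c, hc⟩ := hmaxadd p (hPmax p hpP) a b (v p) hbp
        refine ⟨c, fun _ => ?_, fun h => absurd hpP h, fun _ t ht htp => ?_⟩
        · simpa using neg_mem hc
        · obtain ⟨i, hi⟩ := Set.mem_iUnion.mp ht
          exact absurd hpP (htp ▸ hPQ i t (hFQ i hi))
      · obtain ⟨t, ht, htp⟩ := hp.resolve_left hpP
        obtain ⟨i, hi⟩ := Set.mem_iUnion.mp ht
        by_cases hpf : Finite (R ⧸ p.asIdeal)
        · have hmax : p.asIdeal.IsMaximal := Ideal.Quotient.maximal_of_isField _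
            (Finite.isField_of_domain (R ⧸ p.asIdeal))
          obtain ⟨d, hd⟩ := hG i t (hFQ i hi)
            (by rw [show PrimeSpectrum.comap _ t = p from htp]; exact hpf)
          rw [show PrimeSpectrum.comap _ t = p from htp] at hd
          obtain ⟨c, hc⟩ := hmaxadd p hmax a b d hbp
          exact ⟨c, fun h => absurd h hpP, fun _ _ => hGcongr p _ _ hc hd,
            fun h => absurd hpf (not_finite_iff_infinite.mpr h)⟩
        · by_contra! hbad
          -- each of the finitely many `t` over `p` excludes a single class of `c` modulo `p`
          have hbad' : ∀ c : R ⧸ p.asIdeal, ∃ t : ↥(⋃ i, F i), π t = p ∧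
              y - algebraMap R A (a + b * Quotient.out c) ∈ t.1.asIdeal := by
            intro c
            by_contra! hcon
            exact hbad (Quotient.out c) ⟨fun h => absurd h hpP, fun _ h => absurd h hpf,
              fun _ t ht htp => hcon ⟨t, ht⟩ htp⟩
          choose τ hτp hτ using hbad'
          have := hUfin.to_subtype
          refine hpf (Finite.of_injective τ fun c c' hcc => ?_)
          have h1 := sub_mem (hτ c') (hcc ▸ hτ c)
          have hcomap : ∀ r, algebraMap R A r ∈ (τ c').1.asIdeal → r ∈ p.asIdeal := fun r hr => by
            rw [← hτp c']
            exact hr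
          have h2 : b * (Quotient.out c - Quotient.out c') ∈ p.asIdeal := by
            refine hcomap _ ?_
            convert h1 using 1
            simp only [map_add, map_mul, map_sub]
            ring
          have h3 := (p.isPrime.mem_or_mem h2).resolve_left hbp
          have h4 := (Ideal.Quotient.eq (I := p.asIdeal)).mpr h3
          rw [← Quotient.out_eq c, ← Quotient.out_eq c']
          exact h4)
  simp only [Set.Finite.mem_toFinset] at hb
  refine ⟨b, fun p hp => (hb p (Or.inl hp)).1 hp, fun i t ht hmem => ?_⟩
  obtain ⟨t', ht', hle⟩ := hF i t ht
  have hU : t' ∈ ⋃ i, F i := Set.mem_iUnion.mpr ⟨i, ht'⟩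
  have hgood := hb (π t') (Or.inr ⟨t', hU, rfl⟩)
  refine ⟨t', hFQ i ht', hle, ?_⟩
  by_cases hfin' : Finite (R ⧸ (π t').asIdeal)
  · exact Or.inl ⟨hfin', hgood.2.1 (hPQ i t' (hFQ i ht')) hfin'⟩
  · have hinf := not_finite_iff_infinite.mp hfin'
    refine Or.inr ⟨hinf, lt_of_le_of_ne hle fun heq => ?_⟩
    subst heq
    exact hgood.2.2 hinf t' hU rfl hmem

/-- Choice of several coordinates: each choice either raises the height in `Q i` of the
points remaining on the hypersurfaces `y k = b k`, or these points lie above a point of `Q i` with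
finite residue field downstairs. -/
lemma exists_forall_le_height_or_finite {R A : Type u} [CommRing R] [CommRing A]
    [IsNoetherianRing A] [Algebra R A] {ι : Type*} [Finite ι] {Q : ι → Set (PrimeSpectrum A)}
    (hQ : ∀ i, IsProConstructible (Q i)) {P : Set (PrimeSpectrum R)} (hPfin : P.Finite)
    (hPmax : ∀ p ∈ P, p.asIdeal.IsMaximal)
    (hPQ : ∀ i, ∀ t ∈ Q i, t.comap (algebraMap R A) ∉ P) (v : PrimeSpectrum R → ℕ → R) (y : ℕ → A)
    (j : ℕ) :
    ∃ b : ℕ → R, (∀ p ∈ P, ∀ k < j, b k - v p k ∈ p.asIdeal) ∧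
      ∀ i (t : Q i), (∀ k < j, y k - algebraMap R A (b k) ∈ t.1.asIdeal) →
        (j : ℕ∞) ≤ Order.height t ∨
          ∃ t' ∈ Q i, t' ≤ t ∧ Finite (R ⧸ (t'.comap (algebraMap R A)).asIdeal) := by
  induction j with
  | zero => exact ⟨0, by simp, by simp⟩
  | succ j ih =>
    obtain ⟨b, hbP, hb⟩ := ih
    let Q' : ι → Set (PrimeSpectrum A) := fun i =>
      Q i ∩ PrimeSpectrum.zeroLocus ((fun k => y k - algebraMap R A (b k)) '' Set.Iio j)
    have hQ'mem : ∀ i t, t ∈ Q' i ↔ t ∈ Q i ∧ ∀ k < j, y k - algebraMap R A (b k) ∈ t.asIdeal := by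
      intro i t
      simp [Q', PrimeSpectrum.mem_zeroLocus, Set.subset_def]
    obtain ⟨c, hcP, hc⟩ := exists_forall_exists_le_of_sub_mem (Q := Q')
      (fun i => (hQ i).inter (.of_isClosed (PrimeSpectrum.isClosed_zeroLocus _))) hPfin hPmax
      (fun i t ht => hPQ i t ht.1) (fun p => v p j) (y j) (fun _ _ => True) (by simp) (by simp)
    refine ⟨fun k => if k = j then c else b k, fun p hp k hk => ?_, fun i t ht => ?_⟩
    · rcases eq_or_ne k j with rfl | hkj
      · simpa using hcP p hp
      · simpa [hkj] using hbP p hp k (by omega)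
    · have htj : ∀ k < j, y k - algebraMap R A (b k) ∈ t.1.asIdeal := fun k hk => by
        simpa [hk.ne] using ht k (by omega)
      obtain ⟨t', ht', hle, h | h⟩ := hc i t ((hQ'mem i t).mpr ⟨t.2, htj⟩)
        (by simpa using ht j (by omega))
      · exact Or.inr ⟨t', ht'.1, hle, h.1⟩
      · rcases hb i ⟨t', ht'.1⟩ ((hQ'mem i t').mp ht').2 with h' | ⟨t'', ht'', hle', hfin⟩
        · left
          have hlt : (⟨t', ht'.1⟩ : Q i) < t := h.2
          refine le_trans ?_ (Order.height_add_one_le hlt)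
          push_cast
          gcongr
        · exact Or.inr ⟨t'', ht'', hle'.trans hle, hfin⟩

/-! ### Sections of affine space avoiding sets of primes -/

/-- A nonzero equation for each fiber of `T` over the open set `V` can be chosen with exponents
bounded independently of the fiber: an equation of the fiber at `p` is valid, and nonzero, on a
dense open part of the closure of `p`. -/
lemma exists_forall_exists_degreeOf_lt {R : Type u} [CommRing R] [IsNoetherianRing R] {N : ℕ}
    {ι : Type*} [Finite ι] {T : ι → Set (PrimeSpectrum (MvPolynomial (Fin N) R))}
    (hT : ∀ i, IsProConstructible (T i)) {V : Set (PrimeSpectrum R)} (hV : IsOpen V)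
    (hfib : ∀ s ∈ V, ∃ f : MvPolynomial (Fin N) R, f.map (Ideal.Quotient.mk s.asIdeal) ≠ 0 ∧
      ∀ i, ∀ t ∈ T i, t.comap MvPolynomial.C = s → f ∈ t.asIdeal) :
    ∃ M : ℕ, ∀ s ∈ V, ∃ f : MvPolynomial (Fin N) R,
      f.map (Ideal.Quotient.mk s.asIdeal) ≠ 0 ∧ (∀ l, f.degreeOf l < M) ∧
      ∀ i, ∀ t ∈ T i, t.comap MvPolynomial.C = s → f ∈ t.asIdeal := by
  classical
  suffices h : ∀ B : Set (PrimeSpectrum R), ∃ M : ℕ, ∀ s ∈ V ∩ B, ∃ f : MvPolynomial (Fin N) R,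
      f.map (Ideal.Quotient.mk s.asIdeal) ≠ 0 ∧ (∀ l, f.degreeOf l < M) ∧
      ∀ i, ∀ t ∈ T i, t.comap MvPolynomial.C = s → f ∈ t.asIdeal by
    simpa using h Set.univ
  refine PrimeSpectrum.noetherian_induction_sets _ ⟨0, by simp⟩
    (fun hBC ⟨M, hM⟩ => ⟨M, fun s hs => hM s ⟨hs.1, hBC hs.2⟩⟩) ?_ fun p => ?_
  · rintro B C ⟨M, hM⟩ ⟨M', hM'⟩
    refine ⟨max M M', fun s hs => ?_⟩
    rcases hs.2 with hB | hC
    · obtain ⟨f, h1, h2, h3⟩ := hM s ⟨hs.1, hB⟩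
      exact ⟨f, h1, fun l => lt_max_of_lt_left (h2 l), h3⟩
    · obtain ⟨f, h1, h2, h3⟩ := hM' s ⟨hs.1, hC⟩
      exact ⟨f, h1, fun l => lt_max_of_lt_right (h2 l), h3⟩
  by_cases hp : p ∈ V
  swap
  · refine ⟨1, p.asIdeal.one_notMem, 0, ?_⟩
    rintro s ⟨hsV, hps, -⟩
    exact absurd (((PrimeSpectrum.le_iff_specializes p s).mp hps).mem_open hV hsV) hp
  obtain ⟨f, hf, hfT⟩ := hfib p hp
  obtain ⟨α, hα⟩ := MvPolynomial.ne_zero_iff.mp hf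
  rw [MvPolynomial.coeff_map] at hα
  let π : PrimeSpectrum (MvPolynomial (Fin N) R) → PrimeSpectrum R :=
    PrimeSpectrum.comap MvPolynomial.C
  have hπ : Continuous π := PrimeSpectrum.continuous_comap _
  -- the points of `T` over the closure of `p` at which `f` does not vanish
  let Q : ι → Set (PrimeSpectrum (MvPolynomial (Fin N) R)) := fun i =>
    T i ∩ ((PrimeSpectrum.basicOpen f : Set _) ∩ π ⁻¹' PrimeSpectrum.zeroLocus p.asIdeal)
  have hQ : ∀ i, IsProConstructible (Q i) := fun i => (hT i).inter
    ((IsProConstructible.of_isOpen (PrimeSpectrum.basicOpen f).isOpen).inter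
      (.of_isClosed ((PrimeSpectrum.isClosed_zeroLocus _).preimage hπ)))
  choose F hFQ hFfin hF using fun i => (hQ i).exists_finite_forall_exists_le
  have hUfin : (⋃ i, F i).Finite := Set.finite_iUnion hFfin
  obtain ⟨g, hg, hgp⟩ : ∃ g ∈ hUfin.toFinset.inf fun t => (π t).asIdeal, g ∉ p.asIdeal := by
    refine SetLike.not_le_iff_exists.mp fun hle => ?_
    obtain ⟨t, ht, htp⟩ := (Ideal.IsPrime.inf_le' p.isPrime).mp hle
    obtain ⟨i, hi⟩ := Set.mem_iUnion.mp (hUfin.mem_toFinset.mp ht)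
    have htQ := hFQ i hi
    exact htQ.2.1 (hfT i t htQ.1 (le_antisymm htp htQ.2.2))
  refine ⟨g * f.coeff α, fun hmem => (p.isPrime.mem_or_mem hmem).elim hgp
    fun h => hα (Ideal.Quotient.eq_zero_iff_mem.mpr h),
    (Finset.univ.sup fun l => f.degreeOf l) + 1, ?_⟩
  rintro s ⟨hsV, hps, hs⟩
  refine ⟨f, MvPolynomial.ne_zero_iff.mpr ⟨α, ?_⟩, fun l => Nat.lt_succ_of_le
    (Finset.le_sup (f := fun l => f.degreeOf l) (Finset.mem_univ l)), fun i t ht hts => ?_⟩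
  · rw [MvPolynomial.coeff_map]
    exact fun h => hs (Ideal.mul_mem_left _ _ (Ideal.Quotient.eq_zero_iff_mem.mp h))
  · by_contra hft
    have hps' : p ≤ π t := by rw [show π t = s from hts]; exact hps
    obtain ⟨t', ht', hle⟩ := hF i t ⟨ht, hft, hps'⟩
    have hU := hUfin.mem_toFinset.mpr (Set.mem_iUnion.mpr ⟨i, ht'⟩)
    have hgt : g ∈ (π t').asIdeal := Finset.inf_le (f := fun t => (π t).asIdeal) hU hg
    refine hs (Ideal.mul_mem_right _ _ ?_)
    rw [← hts]
    exact hle hgt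

/-- The value at `p` of the section of affine space with coordinates `a`. -/
noncomputable abbrev sectionPoint {R : Type*} [CommRing R] {σ : Type*} (a : σ → R)
    (p : PrimeSpectrum R) : PrimeSpectrum (MvPolynomial σ R) :=
  p.comap (MvPolynomial.eval a)

lemma comap_C_sectionPoint {R : Type*} [CommRing R] {σ : Type*} (a : σ → R)
    (p : PrimeSpectrum R) : (sectionPoint a p).comap MvPolynomial.C = p := by
  ext x
  simp [sectionPoint]

lemma sectionPoint_congr {R : Type*} [CommRing R] {σ : Type*} {a b : σ → R} {p : PrimeSpectrum R}
    (h : ∀ l, a l - b l ∈ p.asIdeal) : sectionPoint a p = sectionPoint b p := by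
  have hab : (Ideal.Quotient.mk p.asIdeal).comp (MvPolynomial.eval a) =
      (Ideal.Quotient.mk p.asIdeal).comp (MvPolynomial.eval b) :=
    MvPolynomial.ringHom_ext (by simp) fun l => by simpa using Ideal.Quotient.eq.mpr (h l)
  ext f
  have := RingHom.congr_fun hab f
  simp only [RingHom.comp_apply] at this
  rw [sectionPoint, sectionPoint, PrimeSpectrum.comap_asIdeal, PrimeSpectrum.comap_asIdeal,
    Ideal.mem_comap, Ideal.mem_comap, ← Ideal.Quotient.eq_zero_iff_mem, this,
    Ideal.Quotient.eq_zero_iff_mem]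

/-- The theorem in terms of prime ideals, with the dimension of a set of primes measured by chains
of its elements, and with the hypothesis on the fibers reduced to the existence of nonzero
equations. -/
theorem exists_forall_sectionPoint_notMem {R : Type u} [CommRing R] [IsNoetherianRing R] {N : ℕ}
    {ι : Type*} [Finite ι] {T : ι → Set (PrimeSpectrum (MvPolynomial (Fin N) R))}
    (hT : ∀ i, IsProConstructible (T i)) {V : Set (PrimeSpectrum R)} (hV : IsOpen V)
    (hVfin : Vᶜ.Finite) (hVmax : ∀ p ∉ V, p.asIdeal.IsMaximal)
    (hdim : ∀ i, Order.krullDim ↥(T i ∩ PrimeSpectrum.comap MvPolynomial.C ⁻¹' V) < N)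
    (hfib : ∀ s ∈ V, ∃ f : MvPolynomial (Fin N) R, f.map (Ideal.Quotient.mk s.asIdeal) ≠ 0 ∧
      ∀ i, ∀ t ∈ T i, t.comap MvPolynomial.C = s → f ∈ t.asIdeal)
    (hrat : ∀ s : PrimeSpectrum R, s.asIdeal.IsMaximal →
      ∃ v : Fin N → R, ∀ i, sectionPoint v s ∉ T i) :
    ∃ a : Fin N → R, ∀ s i, sectionPoint a s ∉ T i := by
  classical
  obtain ⟨M, hM⟩ := exists_forall_exists_degreeOf_lt hT hV hfib
  cases N with
  | zero =>
    refine ⟨0, fun s i hs => ?_⟩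
    by_cases hsV : s ∈ V
    · have : Nonempty ↥(T i ∩ PrimeSpectrum.comap MvPolynomial.C ⁻¹' V) :=
        ⟨⟨_, hs, by rwa [Set.mem_preimage, comap_C_sectionPoint]⟩⟩
      exact absurd (Order.krullDim_nonneg.trans_lt (hdim i)) (by simp)
    · obtain ⟨v, hv⟩ := hrat s (hVmax s hsV)
      exact hv i (Subsingleton.elim (0 : Fin 0 → R) v ▸ hs)
  | succ n =>
  -- the closed points at which all coordinates are prescribed
  let small := {s : PrimeSpectrum R |
    Finite (R ⧸ s.asIdeal) ∧ Nat.card (R ⧸ s.asIdeal) ≤ M ^ (n + 1)}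
  let P : Set (PrimeSpectrum R) := Vᶜ ∪ small
  have hPfin : P.Finite := hVfin.union (PrimeSpectrum.finite_setOf_card_quotient_le R _)
  have hPmax : ∀ p ∈ P, p.asIdeal.IsMaximal := by
    rintro p (hp | ⟨hp, -⟩)
    · exact hVmax p hp
    · exact Ideal.Quotient.maximal_of_isField _ (Finite.isField_of_domain (R ⧸ p.asIdeal))
  have hPclosed : IsClosed P := by
    rw [← Set.biUnion_of_singleton P]
    exact hPfin.isClosed_biUnion fun p hp =>
      (PrimeSpectrum.isClosed_singleton_iff_isMaximal p).mpr (hPmax p hp)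
  have hexP : ∀ s : PrimeSpectrum R, ∃ v : Fin (n + 1) → R,
      s ∈ P → ∀ i, sectionPoint v s ∉ T i := by
    intro s
    by_cases hs : s ∈ P
    · obtain ⟨v, hv⟩ := hrat s (hPmax s hs)
      exact ⟨v, fun _ => hv⟩
    · exact ⟨0, fun h => absurd h hs⟩
  choose v hv using hexP
  let π : PrimeSpectrum (MvPolynomial (Fin (n + 1)) R) → PrimeSpectrum R :=
    PrimeSpectrum.comap MvPolynomial.C
  have hπ : Continuous π := PrimeSpectrum.continuous_comap _
  let Q : ι → Set (PrimeSpectrum (MvPolynomial (Fin (n + 1)) R)) := fun i => T i ∩ π ⁻¹' Pᶜ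
  have hQ : ∀ i, IsProConstructible (Q i) := fun i =>
    (hT i).inter (.of_isOpen (hPclosed.isOpen_compl.preimage hπ))
  have hQV : ∀ i, Q i ⊆ T i ∩ π ⁻¹' V := fun i t ht =>
    ⟨ht.1, by by_contra h; exact ht.2 (Or.inl h)⟩
  -- the coordinates of Nagata's substitution, other than the variable `X 0` itself, and their
  -- values at the prescribed points
  let y : ℕ → MvPolynomial (Fin (n + 1)) R := fun k => if h : k < n then
    .X (Fin.succ ⟨k, h⟩) - .X 0 ^ M ^ (k + 1) else 0
  let w : PrimeSpectrum R → ℕ → R := fun p k => if h : k < n then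
    v p (Fin.succ ⟨k, h⟩) - v p 0 ^ M ^ (k + 1) else 0
  obtain ⟨b, hbP, hb⟩ := exists_forall_le_height_or_finite hQ hPfin hPmax
    (fun i t ht => ht.2) w y n
  let Q' : ι → Set (PrimeSpectrum (MvPolynomial (Fin (n + 1)) R)) := fun i =>
    Q i ∩ PrimeSpectrum.zeroLocus ((fun k => y k - MvPolynomial.C (b k)) '' Set.Iio n)
  have hQ'mem : ∀ i t, t ∈ Q' i ↔ t ∈ Q i ∧ ∀ k < n, y k - MvPolynomial.C (b k) ∈ t.asIdeal := by
    intro i t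
    simp [Q', PrimeSpectrum.mem_zeroLocus, Set.subset_def]
  -- the coordinates of the section, as functions of the first one
  let a : R → Fin (n + 1) → R := fun c => Fin.cons c fun l => b l + c ^ M ^ ((l : ℕ) + 1)
  have ha : ∀ (p : PrimeSpectrum R) (c c' : R), c - c' ∈ p.asIdeal →
      sectionPoint (a c) p = sectionPoint (a c') p := by
    intro p c c' hc
    refine sectionPoint_congr fun l => ?_
    cases l using Fin.cases with
    | zero => simpa [a] using hc
    | succ l =>
      simpa [a] using Ideal.mem_of_dvd _ (sub_dvd_pow_sub_pow c c' _) hc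
  -- over a finite residue field outside `P`, the equation of the fiber has at most as many roots
  -- on the curve traced by `a` as its degree, which is less than the size of the field
  have hG : ∀ i, ∀ t ∈ Q' i, Finite (R ⧸ (π t).asIdeal) →
      ∃ c, ∀ i, sectionPoint (a c) (π t) ∉ T i := by
    intro i t ht hfin
    have htP : π t ∉ P := ht.1.2
    obtain ⟨f, hf, hfM, hfT⟩ := hM (π t) (by by_contra h; exact htP (Or.inl h))
    have hcard : M ^ (n + 1) < Nat.card (R ⧸ (π t).asIdeal) := by
      by_contra! h
      exact htP (Or.inr ⟨hfin, h⟩)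
    have hfM' : ∀ l, (f.map (Ideal.Quotient.mk (π t).asIdeal)).degreeOf l < M := fun l => by
      refine lt_of_le_of_lt ?_ (hfM l)
      classical
      rw [MvPolynomial.degreeOf_def, MvPolynomial.degreeOf_def]
      exact Multiset.count_le_of_le _ MvPolynomial.degrees_map_le
    have hM0 : M ≠ 0 := (Nat.zero_le _ |>.trans_lt (hfM 0)).ne'
    let q : Fin (n + 1) → Polynomial (R ⧸ (π t).asIdeal) := Fin.cons .X fun l =>
      .X ^ M ^ ((l : ℕ) + 1) + .C (Ideal.Quotient.mk _ (b l))
    obtain ⟨hne, hdeg⟩ := MvPolynomial.aeval_monic_ne_zero_and_natDegree_lt hf hfM' q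
      (fun l => by
        cases l using Fin.cases with
        | zero => exact Polynomial.monic_X
        | succ l => exact Polynomial.monic_X_pow_add_C _ (pow_ne_zero _ hM0))
      (fun l => by
        cases l using Fin.cases with
        | zero => simp [q]
        | succ l => simp [q])
    obtain ⟨c, hc⟩ : ∃ c,
        (MvPolynomial.aeval q (f.map (Ideal.Quotient.mk (π t).asIdeal))).eval c ≠ 0 := by
      by_contra! hall
      have := Fintype.ofFinite (R ⧸ (π t).asIdeal)
      refine hne (Polynomial.eq_zero_of_natDegree_lt_card_of_eval_eq_zero _
        (f := id) Function.injective_id hall ?_)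
      rw [← Nat.card_eq_fintype_card]
      exact hdeg.trans hcard
    obtain ⟨c, rfl⟩ := Ideal.Quotient.mk_surjective c
    have heval : (MvPolynomial.aeval q (f.map (Ideal.Quotient.mk (π t).asIdeal))).eval
        (Ideal.Quotient.mk _ c) = Ideal.Quotient.mk _ (MvPolynomial.eval (a c) f) := by
      have : ((Polynomial.evalRingHom (Ideal.Quotient.mk (π t).asIdeal c)).comp
          (MvPolynomial.aeval q).toRingHom).comp
            (MvPolynomial.map (Ideal.Quotient.mk (π t).asIdeal)) =
          (Ideal.Quotient.mk (π t).asIdeal).comp (MvPolynomial.eval (a c)) := by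
        refine MvPolynomial.ringHom_ext (fun r => ?_) fun l => ?_
        · simp
        · cases l using Fin.cases with
          | zero => simp [q, a]
          | succ l => simp [q, a, add_comm]
      exact RingHom.congr_fun this f
    refine ⟨c, fun i hi => hc ?_⟩
    rw [heval]
    exact Ideal.Quotient.eq_zero_iff_mem.mpr (hfT i _ hi (comap_C_sectionPoint _ _))
  obtain ⟨c, hcP, hc⟩ := exists_forall_exists_le_of_sub_mem (Q := Q')
    (fun i => (hQ i).inter (.of_isClosed (PrimeSpectrum.isClosed_zeroLocus _))) hPfin hPmax
    (fun i t ht => ht.1.2) (fun p => v p 0) (.X 0)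
    (fun p c => ∀ i, sectionPoint (a c) p ∉ T i)
    (fun p c c' h hcp i => by rw [← ha p c c' h]; exact hcp i) hG
  refine ⟨a c, fun s i hs => ?_⟩
  by_cases hsP : s ∈ P
  · refine hv s hsP i ?_
    rwa [sectionPoint_congr (b := a c)]
    intro l
    have h0 := hcP s hsP
    cases l using Fin.cases with
    | zero => simpa [a] using neg_mem h0
    | succ l =>
      have h1 := hbP s hsP l l.2
      simp only [w, l.2, dite_true, Fin.eta] at h1
      have h2 := Ideal.mem_of_dvd _ (sub_dvd_pow_sub_pow c (v s 0) (M ^ ((l : ℕ) + 1))) h0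
      convert neg_mem (add_mem h1 h2) using 1
      simp only [a, Fin.cons_succ]
      ring
  · have hπs : π (sectionPoint (a c) s) = s := comap_C_sectionPoint _ _
    have hsQ : sectionPoint (a c) s ∈ Q i := ⟨hs, by rwa [Set.mem_preimage, hπs]⟩
    have hsQ' : sectionPoint (a c) s ∈ Q' i := by
      refine (hQ'mem i _).mpr ⟨hsQ, fun k hk => ?_⟩
      simp [sectionPoint, y, hk, a, -Fin.succ_mk]
    obtain ⟨t, htQ', hle, ⟨hfin, htT⟩ | ⟨hinf, hlt⟩⟩ := hc i _ hsQ'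
      (by simp [sectionPoint, a])
    · -- `t` lies over a closed point, which is therefore `s`
      have hmax : (π t).asIdeal.IsMaximal := Ideal.Quotient.maximal_of_isField _
        (@Finite.isField_of_domain (R ⧸ (π t).asIdeal) _ _ hfin)
      have hle' : π t ≤ s := hπs ▸ Ideal.comap_mono hle
      have heq : π t = s := PrimeSpectrum.ext (hmax.eq_of_le s.isPrime.ne_top hle')
      have h := htT i
      rw [show PrimeSpectrum.comap (algebraMap R _) t = s from heq] at h
      exact h hs
    · -- otherwise `Q i` contains a chain of length `n + 1` ending at the point of the section
      rcases hb i ⟨t, htQ'.1⟩ ((hQ'mem i t).mp htQ').2 with hht | ⟨t', ht', hle', hfin⟩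
      · have hlt' : (⟨t, htQ'.1⟩ : Q i) < ⟨_, hsQ⟩ := hlt
        have h1 : ((n + 1 : ℕ) : ℕ∞) ≤ Order.height (⟨_, hsQ⟩ : Q i) := by
          refine le_trans ?_ (Order.height_add_one_le hlt')
          push_cast
          gcongr
        have h2 : Order.krullDim (Q i) ≤ Order.krullDim ↥(T i ∩ π ⁻¹' V) :=
          Order.krullDim_le_of_strictMono (Set.inclusion (hQV i)) fun _ _ h => h
        have h3 := (Order.height_le_krullDim (⟨_, hsQ⟩ : Q i)).trans h2 |>.trans_lt (hdim i)
        exact absurd (lt_of_le_of_lt (WithBot.coe_le_coe.mpr h1) h3) (lt_irrefl _)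
      · have hmax : (π t').asIdeal.IsMaximal := Ideal.Quotient.maximal_of_isField _
          (@Finite.isField_of_domain (R ⧸ (π t').asIdeal) _ _ hfin)
        have heq : π t' = π t := PrimeSpectrum.ext
          (hmax.eq_of_le (π t).isPrime.ne_top (Ideal.comap_mono hle'))
        have hinf' : Infinite (R ⧸ (π t).asIdeal) := hinf
        rw [← heq] at hinf'
        exact not_finite_iff_infinite.mpr hinf' hfin

/-! ### Dimension of fibers and coordinates on affine space -/

lemma MvPolynomial.le_height_of_isMaximal {K : Type*} [Field K] {n : ℕ}
    (m : Ideal (MvPolynomial (Fin n) K)) [m.IsMaximal] : (n : ℕ∞) ≤ m.height := by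
  induction n with
  | zero => simp
  | succ n ih =>
    let e := (MvPolynomial.finSuccEquiv K n).toRingEquiv
    have : (m.map e).IsMaximal := Ideal.map_isMaximal_of_equiv e
    have : ((m.map e).under (MvPolynomial (Fin n) K)).IsMaximal :=
      Polynomial.isMaximal_comap_C_of_isJacobsonRing _
    have : (m.map e).LiesOver ((m.map e).under (MvPolynomial (Fin n) K)) := ⟨rfl⟩
    rw [← e.height_map m,
      Polynomial.height_eq_height_add_one ((m.map e).under (MvPolynomial (Fin n) K)) (m.map e)]
    push_cast
    gcongr
    exact ih _

/-- A constructible subset of affine `N`-space over a field that contains the generic point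
contains a nonempty open subset, hence a chain of length `N` ending in a closed point. -/
lemma Topology.IsConstructible.bot_notMem_of_krullDim_lt {K : Type*} [Field K] {N : ℕ}
    {C : Set (PrimeSpectrum (MvPolynomial (Fin N) K))} (hC : Topology.IsConstructible C)
    (hdim : Order.krullDim C < N) : ⊥ ∉ C := by
  intro hbot
  obtain ⟨g, hg, hgC⟩ := hC.exists_basicOpen_mem_iff ⊥
  obtain ⟨m, hm, hgm⟩ : ∃ m : Ideal (MvPolynomial (Fin N) K), m.IsMaximal ∧ g ∉ m := by
    by_contra! h
    refine hg ?_
    have : g ∈ (⊥ : Ideal (MvPolynomial (Fin N) K)).jacobson :=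
      Ideal.mem_sInf.mpr fun {I} hI => h I hI.2
    rwa [IsJacobsonRing.out' ⊥ (Ideal.isRadical_bot)] at this
  have hht := MvPolynomial.le_height_of_isMaximal m
  rw [PrimeSpectrum.height_eq_orderHeight ⟨m, hm.isPrime⟩] at hht
  obtain ⟨c, hlast, hlen⟩ := Order.exists_series_of_le_height _ hht
  have hmem : ∀ i, c i ∈ C := fun i => (hgC (c i) bot_le fun hgi => hgm
    ((show c i ≤ ⟨m, hm.isPrime⟩ from hlast ▸ LTSeries.monotone c (Fin.le_last i)) hgi)).mpr hbot
  let c' : LTSeries C := ⟨c.length, fun i => ⟨c i, hmem i⟩, c.step⟩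
  have := Order.LTSeries.length_le_krullDim c'
  rw [show c'.length = N from hlen] at this
  exact absurd (this.trans_lt hdim) (lt_irrefl _)

/-- Chains in a set of primes give chains of irreducible closed subsets of the set. -/
lemma PrimeSpectrum.krullDim_le_topologicalKrullDim {A : Type*} [CommRing A]
    (T : Set (PrimeSpectrum A)) : Order.krullDim T ≤ topologicalKrullDim T := by
  have hle : ∀ a b : T, a ≤ b ↔ closure {b} ⊆ closure {a} := fun a b => by
    rw [← specializes_iff_closure_subset, subtype_specializes_iff]
    exact PrimeSpectrum.le_iff_specializes _ _
  rw [topologicalKrullDim, ← Order.krullDim_orderDual]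
  refine Order.krullDim_le_of_strictMono (fun t : Tᵒᵈ =>
    (⟨closure {t.ofDual}, isIrreducible_singleton.closure, isClosed_closure⟩ :
      TopologicalSpace.IrreducibleCloseds T)) fun a b hab => ?_
  exact lt_of_le_not_ge ((hle _ _).mp hab.le) fun h => hab.not_ge ((hle _ _).mpr h)

/-- Affine `N`-space over an affine base is the spectrum of the polynomial ring in the variables
indexed by `Fin N`. -/
noncomputable def affineNSpaceSpecIso (N : ℕ) (R : CommRingCat.{u}) :
    Spec (.of (MvPolynomial (Fin N) R)) ≅ affineNSpace N (Spec R) :=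
  Scheme.Spec.mapIso (MvPolynomial.renameEquiv R
    Equiv.ulift.{u, 0}).toRingEquiv.toCommRingCatIso.op ≪≫ (AffineSpace.SpecIso _ R).symm

lemma affineNSpaceSpecIso_hom (N : ℕ) (R : CommRingCat.{u}) :
    (affineNSpaceSpecIso N R).hom = Spec.map (CommRingCat.ofHom
      (MvPolynomial.rename (R := R) (ULift.down : ULift.{u} (Fin N) → Fin N)).toRingHom) ≫
        (AffineSpace.SpecIso _ R).inv := rfl

lemma affineNSpaceSpecIso_hom_over (N : ℕ) (R : CommRingCat.{u}) :
    (affineNSpaceSpecIso N R).hom ≫ affineNSpaceProj N (Spec R) =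
      Spec.map (CommRingCat.ofHom MvPolynomial.C) := by
  rw [affineNSpaceSpecIso_hom, Category.assoc, AffineSpace.SpecIso_inv_over, ← Spec.map_comp,
    ← CommRingCat.ofHom_comp]
  congr 2
  ext r
  simp

lemma affineNSpaceSpecIso_hom_map (N : ℕ) {R K : CommRingCat.{u}} (φ : R ⟶ K) :
    (affineNSpaceSpecIso N K).hom ≫ AffineSpace.map _ (Spec.map φ) =
      Spec.map (CommRingCat.ofHom (MvPolynomial.map φ.hom)) ≫ (affineNSpaceSpecIso N R).hom := by
  rw [AffineSpace.map_SpecMap, affineNSpaceSpecIso_hom, affineNSpaceSpecIso_hom, Category.assoc,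
    Iso.inv_hom_id_assoc, ← Spec.map_comp_assoc, ← Spec.map_comp_assoc, ← CommRingCat.ofHom_comp,
    ← CommRingCat.ofHom_comp]
  congr 3
  refine MvPolynomial.ringHom_ext (fun r => ?_) fun i => ?_ <;> simp

/-- The ring homomorphism from `R` to the residue field at a point of `Spec R`. -/
noncomputable def toResidueField {R : CommRingCat.{u}} (s : Spec R) :
    R ⟶ (Spec R).residueField s :=
  Spec.preimage ((Spec R).fromSpecResidueField s)

lemma SpecMap_toResidueField {R : CommRingCat.{u}} (s : Spec R) :
    Spec.map (toResidueField s) = (Spec R).fromSpecResidueField s :=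
  Spec.map_preimage _

lemma toResidueField_eq {R : CommRingCat.{u}} (s : PrimeSpectrum R) :
    toResidueField (R := R) s = CommRingCat.ofHom (algebraMap R s.asIdeal.ResidueField) ≫
      (Scheme.Spec.residueFieldIso R s).inv :=
  Spec.map_injective ((SpecMap_toResidueField _).trans
    ((Spec.map_comp _ _).trans
      (Scheme.Spec.map_residueFieldIso_inv_eq_fromSpecResidueField R s)).symm)

lemma toResidueField_eq_zero_iff {R : CommRingCat.{u}} (s : PrimeSpectrum R) (r : R) :
    (toResidueField (R := R) s).hom r = 0 ↔ r ∈ s.asIdeal := by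
  rw [toResidueField_eq]
  exact (map_eq_zero_iff (Scheme.Spec.residueFieldIso R s).symm.commRingCatIsoToRingEquiv
    (RingEquiv.injective _)).trans Ideal.algebraMap_residueField_eq_zero

lemma toResidueField_surjective {R : CommRingCat.{u}} (s : PrimeSpectrum R)
    (hs : s.asIdeal.IsMaximal) : Function.Surjective (toResidueField (R := R) s).hom := by
  rw [toResidueField_eq]
  exact (Scheme.Spec.residueFieldIso R s).symm.commRingCatIsoToRingEquiv.surjective.comp
    s.asIdeal.algebraMap_residueField_surjective

instance (N : ℕ) (S : Scheme.{u}) (s : S) : IsPreimmersion (affineNSpaceFiberMap N S s) :=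
  MorphismProperty.of_isPullback (P := @IsPreimmersion)
    (AffineSpace.isPullback_map (S.fromSpecResidueField s)).flip inferInstance

lemma range_affineNSpaceFiberMap (N : ℕ) (S : Scheme.{u}) (s : S) :
    Set.range (affineNSpaceFiberMap N S s) = affineNSpaceProj N S ⁻¹' {s} := by
  have h := AffineSpace.isPullback_map (n := ULift.{u} (Fin N)) (S.fromSpecResidueField s)
  rw [← S.range_fromSpecResidueField s, ← Scheme.Pullback.range_fst, ← h.isoPullback_inv_fst]
  simp only [Scheme.Hom.comp_base, TopCat.hom_comp, ContinuousMap.coe_comp]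
  exact (Function.Surjective.range_comp (h.isoPullback.inv.surjective) _).symm

/-! ### Fibers and sections in terms of polynomial rings -/

lemma IsProConstructible.preimage_of_isOpenEmbedding {X Y : Type u} [TopologicalSpace X]
    [TopologicalSpace Y] {f : X → Y} (hf : Topology.IsOpenEmbedding f) {T : Set Y}
    (hT : IsProConstructible T) : IsProConstructible (f ⁻¹' T) := by
  obtain ⟨𝒞, h𝒞, rfl⟩ := hT
  refine ⟨Set.preimage f '' 𝒞, ?_, by simp [Set.preimage_sInter, Set.sInter_image]⟩
  rintro _ ⟨C, hC, rfl⟩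
  exact (h𝒞 C hC).preimage_of_isOpenEmbedding hf

lemma comap_C_comap_map {R K : Type*} [CommRing R] [Field K] {σ : Type*} {φ : R →+* K}
    {s : PrimeSpectrum R} (hφ : ∀ r, φ r = 0 ↔ r ∈ s.asIdeal)
    (z : PrimeSpectrum (MvPolynomial σ K)) :
    (z.comap (MvPolynomial.map φ)).comap MvPolynomial.C = s := by
  ext r
  rw [PrimeSpectrum.comap_asIdeal, PrimeSpectrum.comap_asIdeal, Ideal.mem_comap,
    Ideal.mem_comap, MvPolynomial.map_C, ← hφ]
  refine ⟨fun h => ?_, fun h => by rw [h, map_zero]; exact zero_mem _⟩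
  by_contra hne
  exact z.isPrime.ne_top (Ideal.eq_top_of_isUnit_mem _ h
    ((isUnit_iff_ne_zero.mpr hne).map MvPolynomial.C))

/-- If finitely many sets have constructible fibers of dimension less than `N` at `s`, then these
fibers are contained in a common hypersurface, with an equation defined over the base. Here
`φ : R →+* K` plays the role of the canonical homomorphism to the residue field at `s`. -/
lemma exists_map_ne_zero_forall_mem {R K : Type*} [CommRing R] [CommRing K] (hK : IsField K)
    {N : ℕ} {φ : R →+* K} {s : PrimeSpectrum R} (hφ : ∀ r, φ r = 0 ↔ r ∈ s.asIdeal)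
    (hemb : Topology.IsEmbedding (PrimeSpectrum.comap (MvPolynomial.map (σ := Fin N) φ)))
    (hrange : ∀ t : PrimeSpectrum (MvPolynomial (Fin N) R), t.comap MvPolynomial.C = s →
      ∃ z, PrimeSpectrum.comap (MvPolynomial.map φ) z = t)
    {ι : Type*} [Finite ι] {T : ι → Set (PrimeSpectrum (MvPolynomial (Fin N) R))}
    (hT : ∀ i, Topology.IsConstructible (PrimeSpectrum.comap (MvPolynomial.map φ) ⁻¹' T i))
    (hdim : ∀ i, Order.krullDim ↥(T i ∩ PrimeSpectrum.comap MvPolynomial.C ⁻¹' {s}) < N) :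
    ∃ f : MvPolynomial (Fin N) R, f.map (Ideal.Quotient.mk s.asIdeal) ≠ 0 ∧
      ∀ i, ∀ t ∈ T i, t.comap MvPolynomial.C = s → f ∈ t.asIdeal := by
  let _ := hK.toField
  have := Fintype.ofFinite ι
  have hbot : ∀ i, ⊥ ∉ PrimeSpectrum.comap (MvPolynomial.map φ) ⁻¹' T i := fun i => by
    refine (hT i).bot_notMem_of_krullDim_lt (lt_of_le_of_lt ?_ (hdim i))
    have hmono : StrictMono (PrimeSpectrum.comap (MvPolynomial.map (σ := Fin N) φ)) :=
      Monotone.strictMono_of_injective (fun _ _ h => Ideal.comap_mono h) hemb.injective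
    exact Order.krullDim_le_of_strictMono
      (fun z => ⟨_, z.2, comap_C_comap_map hφ z.1⟩) fun a b hab => hmono hab
  have hf : ∀ i, ∃ f : MvPolynomial (Fin N) R, f.map φ ≠ 0 ∧
      ∀ t ∈ T i, t.comap MvPolynomial.C = s → f ∈ t.asIdeal := by
    intro i
    obtain ⟨g, hg, hgT⟩ := (hT i).exists_basicOpen_mem_iff ⊥
    -- the open set `D(g)` of the fiber is induced by an open set of the total space
    obtain ⟨U, hU, hUg⟩ := hemb.isOpen_iff.mp (PrimeSpectrum.basicOpen g).isOpen
    have hbU : PrimeSpectrum.comap (MvPolynomial.map φ) ⊥ ∈ U := by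
      rw [← Set.mem_preimage, hUg]; exact hg
    obtain ⟨_, ⟨f, rfl⟩, hf, hfU⟩ :=
      PrimeSpectrum.isTopologicalBasis_basic_opens.exists_subset_of_mem_open hbU hU
    refine ⟨f, hf, fun t ht hts => ?_⟩
    by_contra hft
    obtain ⟨z, rfl⟩ := hrange t hts
    have hzg : z ∈ PrimeSpectrum.comap (MvPolynomial.map φ) ⁻¹' U := hfU hft
    rw [hUg] at hzg
    exact hbot i ((hgT z bot_le hzg).mp ht)
  choose f hf hfT using hf
  refine ⟨∏ i, f i, fun h0 => ?_, fun i t ht hts =>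
    Ideal.mem_of_dvd _ (Finset.dvd_prod_of_mem f (Finset.mem_univ i)) (hfT i t ht hts)⟩
  have h1 : (∏ i, f i).map φ ≠ 0 := by
    rw [map_prod]
    exact Finset.prod_ne_zero_iff.mpr fun i _ => hf i
  refine h1 (MvPolynomial.ext _ _ fun α => ?_)
  have h2 := congrArg (MvPolynomial.coeff α) h0
  rw [MvPolynomial.coeff_map, MvPolynomial.coeff_zero, Ideal.Quotient.eq_zero_iff_mem] at h2
  rw [MvPolynomial.coeff_map, MvPolynomial.coeff_zero]
  exact (hφ _).mpr h2

/-- The fiber over `s` is, in coordinates, the map of spectra given by reducing coefficients. -/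
lemma affineNSpaceSpecIso_hom_fiberMap (N : ℕ) {R : CommRingCat.{u}} (s : Spec R) :
    (affineNSpaceSpecIso N ((Spec R).residueField s)).hom ≫ affineNSpaceFiberMap N (Spec R) s =
      Spec.map (CommRingCat.ofHom (MvPolynomial.map (toResidueField s).hom)) ≫
        (affineNSpaceSpecIso N R).hom := by
  rw [← affineNSpaceSpecIso_hom_map, SpecMap_toResidueField]

lemma isEmbedding_comap_map_toResidueField (N : ℕ) {R : CommRingCat.{u}} (s : Spec R) :
    Topology.IsEmbedding (PrimeSpectrum.comap
      (MvPolynomial.map (σ := Fin N) (toResidueField s).hom)) := by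
  have h : Spec.map (CommRingCat.ofHom (MvPolynomial.map (σ := Fin N) (toResidueField s).hom)) =
      (affineNSpaceSpecIso N ((Spec R).residueField s)).hom ≫
        affineNSpaceFiberMap N (Spec R) s ≫ (affineNSpaceSpecIso N R).inv := by
    rw [← Category.assoc, Iso.eq_comp_inv, affineNSpaceSpecIso_hom_fiberMap]
  have : IsPreimmersion (Spec.map
      (CommRingCat.ofHom (MvPolynomial.map (σ := Fin N) (toResidueField s).hom))) := by
    rw [h]; infer_instance
  exact (Spec.map (CommRingCat.ofHom
    (MvPolynomial.map (σ := Fin N) (toResidueField s).hom))).isEmbedding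

lemma affineNSpaceFiberMap_affineNSpaceSpecIso_hom {N : ℕ} {R : CommRingCat.{u}} (s : Spec R)
    (z : Spec (.of (MvPolynomial (Fin N) ((Spec R).residueField s)))) :
    affineNSpaceFiberMap N (Spec R) s ((affineNSpaceSpecIso N _).hom z) =
      (affineNSpaceSpecIso N R).hom
        (Spec.map (CommRingCat.ofHom (MvPolynomial.map (toResidueField s).hom)) z) := by
  rw [← Scheme.Hom.comp_apply, affineNSpaceSpecIso_hom_fiberMap, Scheme.Hom.comp_apply]

lemma preimage_fiberSet {N : ℕ} {R : CommRingCat.{u}} (s : Spec R)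
    (T : Set (affineNSpace N (Spec R))) :
    (affineNSpaceSpecIso N ((Spec R).residueField s)).hom ⁻¹' fiberSet T s =
      PrimeSpectrum.comap (MvPolynomial.map (toResidueField s).hom) ⁻¹'
        ((affineNSpaceSpecIso N R).hom ⁻¹' T) :=
  Set.ext fun z => iff_of_eq
    (congrArg (· ∈ T) (affineNSpaceFiberMap_affineNSpaceSpecIso_hom s z))

lemma affineNSpaceProj_affineNSpaceSpecIso_hom {N : ℕ} {R : CommRingCat.{u}}
    (t : Spec (.of (MvPolynomial (Fin N) R))) :
    affineNSpaceProj N (Spec R) ((affineNSpaceSpecIso N R).hom t) =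
      Spec.map (CommRingCat.ofHom MvPolynomial.C) t := by
  rw [← Scheme.Hom.comp_apply, affineNSpaceSpecIso_hom_over]

lemma exists_comap_map_toResidueField_eq {N : ℕ} {R : CommRingCat.{u}} {s : Spec R}
    {t : Spec (.of (MvPolynomial (Fin N) R))}
    (h : Spec.map (CommRingCat.ofHom MvPolynomial.C) t = s) :
    ∃ z, Spec.map (CommRingCat.ofHom (MvPolynomial.map (toResidueField s).hom)) z = t := by
  have hmem : (affineNSpaceSpecIso N R).hom t ∈ Set.range (affineNSpaceFiberMap N (Spec R) s) := by
    rw [range_affineNSpaceFiberMap]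
    exact (affineNSpaceProj_affineNSpaceSpecIso_hom t).trans h
  obtain ⟨z, hz⟩ := hmem
  obtain ⟨z, rfl⟩ := (affineNSpaceSpecIso N ((Spec R).residueField s)).hom.surjective z
  refine ⟨z, (affineNSpaceSpecIso N R).hom.injective ?_⟩
  rw [← hz, affineNSpaceFiberMap_affineNSpaceSpecIso_hom]

lemma exists_map_ne_zero_of_isConstructible_fiberSet {N : ℕ} {R : CommRingCat.{u}}
    {ι : Type*} [Finite ι] {T : ι → Set (affineNSpace N (Spec R))}
    {T' : ι → Set (PrimeSpectrum (MvPolynomial (Fin N) R))}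
    (hT' : ∀ i, T' i = (affineNSpaceSpecIso N R).hom ⁻¹' T i) (s : PrimeSpectrum R)
    (hT : ∀ i, Topology.IsConstructible (fiberSet (S := Spec R) (T i) s))
    (hdim : ∀ i, Order.krullDim ↥(T' i ∩ PrimeSpectrum.comap MvPolynomial.C ⁻¹' {s}) < N) :
    ∃ f : MvPolynomial (Fin N) R, f.map (Ideal.Quotient.mk s.asIdeal) ≠ 0 ∧
      ∀ i, ∀ t ∈ T' i, t.comap MvPolynomial.C = s → f ∈ t.asIdeal := by
  have hcons : ∀ i, Topology.IsConstructible (PrimeSpectrum.comap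
      (MvPolynomial.map (σ := Fin N) (toResidueField (R := R) s).hom) ⁻¹' T' i) := fun i => by
    have h := (hT i).preimage_of_isOpenEmbedding
      (affineNSpaceSpecIso N ((Spec R).residueField _)).hom.isOpenEmbedding
    rw [hT' i]
    exact (congrArg Topology.IsConstructible (preimage_fiberSet (R := R) s (T i))).mp h
  have hemb := isEmbedding_comap_map_toResidueField N (R := R) s
  have hzero := toResidueField_eq_zero_iff s
  have hrange : ∀ t : PrimeSpectrum (MvPolynomial (Fin N) R), t.comap MvPolynomial.C = s →
      ∃ z, PrimeSpectrum.comap (MvPolynomial.map (toResidueField (R := R) s).hom) z = t :=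
    fun t ht => exists_comap_map_toResidueField_eq (R := R) ht
  have hK : IsField ((Spec R).residueField s) :=
    Field.toIsField ((Spec R).residueField (show Spec R from s))
  exact exists_map_ne_zero_forall_mem hK hzero hemb hrange hcons hdim

/-- A rational point of the fiber at a closed point lifts to a section. -/
lemma exists_sectionPoint_eq {N : ℕ} {R : CommRingCat.{u}} (s : Spec R)
    (hs : Function.Surjective (toResidueField s).hom)
    (x : Spec ((Spec R).residueField s) ⟶ affineNSpace N (Spec ((Spec R).residueField s)))
    (hx : x ≫ affineNSpaceProj N (Spec ((Spec R).residueField s)) = 𝟙 _) :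
    ∃ (v : Fin N → R) (p : _), (affineNSpaceSpecIso N R).hom (sectionPoint v s) =
      affineNSpaceFiberMap N (Spec R) s (x p) := by
  obtain ⟨χ, hχ⟩ : ∃ χ : CommRingCat.of (MvPolynomial (Fin N) R) ⟶ (Spec R).residueField s,
      Spec.map χ = x ≫ affineNSpaceFiberMap N (Spec R) s ≫ (affineNSpaceSpecIso N R).inv :=
    ⟨Spec.preimage _, Spec.map_preimage _⟩
  have hχC : CommRingCat.ofHom MvPolynomial.C ≫ χ = toResidueField s := by
    rw [← Spec.map_inj, Spec.map_comp, hχ, SpecMap_toResidueField, ← affineNSpaceSpecIso_hom_over]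
    simp only [Category.assoc, Iso.inv_hom_id_assoc]
    exact (congrArg (x ≫ ·) (AffineSpace.map_over ((Spec R).fromSpecResidueField s))).trans
      ((Category.assoc _ _ _).symm.trans
        ((congrArg (· ≫ (Spec R).fromSpecResidueField s) hx).trans (Category.id_comp _)))
  choose v hv using fun l => hs (χ.hom (MvPolynomial.X l))
  have hev : CommRingCat.ofHom (MvPolynomial.eval v) ≫ toResidueField s = χ := by
    ext : 1
    refine MvPolynomial.ringHom_ext (fun r => ?_) fun l => ?_
    · simpa using (congrArg (fun f => f.hom r) hχC).symm
    · simpa using hv l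
  let p : Spec ((Spec R).residueField s) := default
  refine ⟨v, p, ?_⟩
  have hp : Spec.map (toResidueField s) p = s := by
    have : Spec.map (toResidueField s) p ∈ Set.range ((Spec R).fromSpecResidueField s) := by
      rw [← SpecMap_toResidueField]; exact ⟨p, rfl⟩
    rwa [Scheme.range_fromSpecResidueField] at this
  have h1 : sectionPoint v s = Spec.map χ p := by
    rw [← hev, Spec.map_comp, Scheme.Hom.comp_apply, hp]
    rfl
  rw [h1, ← Scheme.Hom.comp_apply, hχ, ← Scheme.Hom.comp_apply]
  simp only [Category.assoc, Iso.inv_hom_id, Category.comp_id]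

theorem theorem2p1 (R : Type u) [CommRing R] [IsNoetherianRing R] (N m : ℕ)
    (T : Fin m → Set (affineNSpace N (Spec (CommRingCat.of R))))
    (hT : ∀ i, IsProConstructible (T i))
    (h1 : ∃ V : (Spec (CommRingCat.of R)).Opens,
      topologicalKrullDim ↥((V : Set (Spec (CommRingCat.of R)))ᶜ) ≤ 0 ∧
      ∀ i,
        topologicalKrullDim
          ↥(T i ∩ affineNSpaceProj N (Spec (CommRingCat.of R)) ⁻¹' V) < (N : WithBot ℕ∞) ∧
        ∀ s ∈ V, Topology.IsConstructible (fiberSet (T i) s))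
    (h2 : ∀ s : Spec (CommRingCat.of R),
      ∃ x : Spec ((Spec (CommRingCat.of R)).residueField s) ⟶
          affineNSpace N (Spec ((Spec (CommRingCat.of R)).residueField s)),
        x ≫ affineNSpaceProj N (Spec ((Spec (CommRingCat.of R)).residueField s)) = 𝟙 _ ∧
        ∀ p, x p ∉ fiberSet (⋃ i, T i) s) :
    ∃ σ : Spec (CommRingCat.of R) ⟶ affineNSpace N (Spec (CommRingCat.of R)),
      σ ≫ affineNSpaceProj N (Spec (CommRingCat.of R)) = 𝟙 _ ∧
      Set.range σ ∩ (⋃ i, T i) = ∅ := by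
  obtain ⟨V, hV0, hV⟩ := h1
  let j := (affineNSpaceSpecIso N (CommRingCat.of R)).hom
  let T' : Fin m → Set (PrimeSpectrum (MvPolynomial (Fin N) R)) := fun i => j ⁻¹' T i
  let W : Set (PrimeSpectrum R) := V.1
  have hW : IsOpen W := V.isOpen
  have hT' : ∀ i, IsProConstructible (T' i) := fun i =>
    (hT i).preimage_of_isOpenEmbedding j.isOpenEmbedding
  -- the complement of `W` is a finite set of closed points
  have hWmin : ∀ a : ↥Wᶜ, IsMax a := Order.krullDim_nonpos_iff_forall_isMax.mp
    ((PrimeSpectrum.krullDim_le_topologicalKrullDim Wᶜ).trans hV0)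
  have hWmax : ∀ p ∉ W, p.asIdeal.IsMaximal := by
    intro p hp
    obtain ⟨I, hI, hpI⟩ := p.asIdeal.exists_le_maximal p.isPrime.ne_top
    have hle : p ≤ ⟨I, hI.isPrime⟩ := hpI
    have hIW : (⟨I, hI.isPrime⟩ : PrimeSpectrum R) ∉ W := fun h =>
      hp (((PrimeSpectrum.le_iff_specializes _ _).mp hle).mem_open hW h)
    have hge : I ≤ p.asIdeal := hWmin ⟨p, hp⟩ (b := ⟨_, hIW⟩) hle
    rwa [le_antisymm hpI hge]
  have hWfin : Wᶜ.Finite := by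
    obtain ⟨F, hFW, hF, hFle⟩ :=
      (IsProConstructible.of_isClosed hW.isClosed_compl).exists_finite_forall_exists_le
    refine hF.subset fun q hq => ?_
    obtain ⟨p, hp, hpq⟩ := hFle q hq
    rwa [← PrimeSpectrum.ext ((hWmax p (hFW hp)).eq_of_le q.isPrime.ne_top hpq)]
  have hdim : ∀ i, Order.krullDim ↥(T' i ∩ PrimeSpectrum.comap MvPolynomial.C ⁻¹' W) < N := by
    intro i
    have heq : T' i ∩ PrimeSpectrum.comap MvPolynomial.C ⁻¹' W =
        j ⁻¹' (T i ∩ affineNSpaceProj N (Spec (CommRingCat.of R)) ⁻¹' V) := by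
      ext t
      refine and_congr_right fun _ => ?_
      exact iff_of_eq (congrArg (· ∈ W)
        (affineNSpaceProj_affineNSpaceSpecIso_hom (R := .of R) t).symm)
    rw [heq]
    exact (PrimeSpectrum.krullDim_le_topologicalKrullDim _).trans
      (j.isEmbedding.isInducing.restrictPreimage _).topologicalKrullDim_le |>.trans_lt (hV i).1
  have hfib : ∀ s ∈ W, ∃ f : MvPolynomial (Fin N) R, f.map (Ideal.Quotient.mk s.asIdeal) ≠ 0 ∧
      ∀ i, ∀ t ∈ T' i, t.comap MvPolynomial.C = s → f ∈ t.asIdeal := by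
    intro s hs
    refine exists_map_ne_zero_of_isConstructible_fiberSet (R := .of R) (T' := T')
      (fun _ => rfl) s
      (fun i => (hV i).2 s hs) fun i => ?_
    have hsub : T' i ∩ PrimeSpectrum.comap MvPolynomial.C ⁻¹' {s} ⊆
        T' i ∩ PrimeSpectrum.comap MvPolynomial.C ⁻¹' W :=
      Set.inter_subset_inter_right _ (Set.preimage_mono (Set.singleton_subset_iff.mpr hs))
    exact (Order.krullDim_le_of_strictMono (Set.inclusion hsub) fun _ _ h => h).trans_lt (hdim i)
  have hrat : ∀ s : PrimeSpectrum R, s.asIdeal.IsMaximal →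
      ∃ v : Fin N → R, ∀ i, sectionPoint v s ∉ T' i := by
    intro s hs
    obtain ⟨x, hx, hxT⟩ := h2 s
    obtain ⟨v, p, hv⟩ := exists_sectionPoint_eq (R := .of R) s
      (toResidueField_surjective (R := .of R) s hs) x hx
    refine ⟨v, fun i hi => hxT p ?_⟩
    exact Set.mem_iUnion.mpr ⟨i, hv ▸ hi⟩
  obtain ⟨a, ha⟩ := exists_forall_sectionPoint_notMem hT' hW hWfin hWmax hdim hfib hrat
  refine ⟨Spec.map (CommRingCat.ofHom (MvPolynomial.eval a)) ≫ j, ?_, ?_⟩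
  · rw [Category.assoc, affineNSpaceSpecIso_hom_over, ← Spec.map_comp, ← CommRingCat.ofHom_comp,
      show (MvPolynomial.eval a).comp MvPolynomial.C = RingHom.id R from
        RingHom.ext fun r => MvPolynomial.eval_C r, CommRingCat.ofHom_id, Spec.map_id]
  · refine Set.eq_empty_iff_forall_notMem.mpr ?_
    rintro _ ⟨⟨s, rfl⟩, hs⟩
    obtain ⟨i, hi⟩ := Set.mem_iUnion.mp hs
    exact ha s i hi
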